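/- Let $\Gamma$ be a finite simple graph with vertex set $X$, let $G$ be the right-angled Artin group and $M$ the right-angled Artin monoid defined by $\Gamma$ (generators $X$, one relation $ab=ba$ for each edge $a-b$). Fix a total order $<$ on $X\cup X^{-1}$ such that for each edge $a-b$ either $a^{\varepsilon}<b^{\delta}$ for all signs $\varepsilon,\delta=\pm1$, or $a^{\varepsilon}>b^{\delta}$ for all signs, and order words by the induced length-lexicographical order. Let $\Re_0$ be the rewriting system on $(X\cup X^{-1})^*$ consisting of the rules $a^{\varepsilon}b^{\delta}\to b^{\delta}a^{\varepsilon}$ ($a-b$ an edge, $a^{\varepsilon}>b^{\delta}$, $\varepsilon,\delta=\pm1$) and $aa^{-1}\to1$, $a^{-1}a\to1$ ($a\in X$). A run of the Knuth-Bendix completion algorithm on $\Re_0$ is a sequence $\Re_0\subseteq\Re_1\subseteq\Re_2\subseteq\cdots$ such that every rule of $\Re_{n+1}\setminus\Re_n$ is obtained by reducing both words of a critical pair of $\Re_n$ (from an overlap or an inclusion of left-hand sides) to irreducible words modulo $\Re_n$ and orienting the two distinct results from the larger to the smaller one, and such that for every $n$ and every overlap of rules of $\Re_n$ the two words of its critical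 pair have a common descendant modulo $\Re_m$ for some $m$. Write $\Re=\bigcup_n\Re_n$ for the system obtained from the run, and for a system $S$ write $S^+$ for the set of its rules whose left-hand side is a positive word (a word in $X^*$). Then such runs exist, and for every run: 1. $\Re$ is complete (terminating and confluent) and equivalent to $\Re_0$ (the two systems generate the same congruence). 2. $\Re^+$ is a rewriting system for $M$: every rule of $\Re^+$ has a positive right-hand side, and $M$ is isomorphic to the factor monoid $X^*/\equiv_{\Re^+}$, by an isomorphism that is the identity on the generators. 3. At every step $n$ of the run, $\Re_n^+$ is likewise a rewriting system for $M$, in the same sense. -/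

import Mathlib

namespace RightAngledArtin

/-! ### Rewriting systems on words -/

/-- A rewriting system on the alphabet `A`: a set of rules `(l, r)`, read `l → r`. -/
abbrev RewritingSystem (A : Type*) := Set (List A × List A)

/-- One reduction step: `u l v → u r v` for a rule `(l, r)`. -/
def Reduces {A : Type*} (R : RewritingSystem A) (w z : List A) : Prop :=
  ∃ u v l r : List A, (l, r) ∈ R ∧ w = u ++ l ++ v ∧ z = u ++ r ++ v

/-- The reflexive transitive closure `→*` of the reduction relation. -/
def ReducesStar {A : Type*} (R : RewritingSystem A) : List A → List A → Prop :=
  Relation.ReflTransGen (Reduces R)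

/-- The congruence `≡_R` (also written `↔*`): the equivalence relation generated by reduction. -/
def Congruent {A : Type*} (R : RewritingSystem A) : List A → List A → Prop :=
  Relation.EqvGen (Reduces R)

def IsIrreducible {A : Type*} (R : RewritingSystem A) (w : List A) : Prop :=
  ¬ ∃ z, Reduces R w z

/-- Two words have a common descendant. -/
def HaveCommonDescendant {A : Type*} (R : RewritingSystem A) (p q : List A) : Prop :=
  ∃ z, ReducesStar R p z ∧ ReducesStar R q z

def IsTerminating {A : Type*} (R : RewritingSystem A) : Prop :=
  ¬ ∃ w : ℕ → List A, ∀ n, Reduces R (w n) (w (n + 1))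

def IsConfluent {A : Type*} (R : RewritingSystem A) : Prop :=
  ∀ w u v, ReducesStar R w u → ReducesStar R w v → HaveCommonDescendant R u v

def IsComplete {A : Type*} (R : RewritingSystem A) : Prop :=
  IsTerminating R ∧ IsConfluent R

/-- Two rewriting systems are equivalent if they generate the same congruence. -/
def AreEquivalent {A : Type*} (R R' : RewritingSystem A) : Prop :=
  ∀ u v, Congruent R u v ↔ Congruent R' u v

/-! ### Critical pairs and completion -/

/-- `(p, q)` is the critical pair of an overlap ambiguity `u, v, w` (three non-empty words)
between the rules `uv → r₁` and `vw → r₂`. -/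
def IsOverlapPair {A : Type*} (R : RewritingSystem A) (p q : List A) : Prop :=
  ∃ u v w r₁ r₂ : List A, u ≠ [] ∧ v ≠ [] ∧ w ≠ [] ∧
    (u ++ v, r₁) ∈ R ∧ (v ++ w, r₂) ∈ R ∧ p = r₁ ++ w ∧ q = u ++ r₂

/-- `(p, q)` is the critical pair of an inclusion ambiguity between the rules `v → r₁` and
`uvw → r₂`. -/
def IsInclusionPair {A : Type*} (R : RewritingSystem A) (p q : List A) : Prop :=
  ∃ u v w r₁ r₂ : List A, (u = [] → w = [] → r₁ ≠ r₂) ∧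
    (v, r₁) ∈ R ∧ (u ++ v ++ w, r₂) ∈ R ∧ p = u ++ r₁ ++ w ∧ q = r₂

/-- `ρ` is a rule produced from `R` by the completion algorithm, with respect to the
length-lexicographical order induced by the order `lt` of the letters: the two words of some
critical pair of `R` are reduced to irreducible words modulo `R`, and the two resulting words
are oriented from the larger one to the smaller one. -/
def IsProducedRule {A : Type*} (lt : A → A → Prop) (R : RewritingSystem A)
    (ρ : List A × List A) : Prop :=
  ∃ p q p' q' : List A, (IsOverlapPair R p q ∨ IsInclusionPair R p q) ∧
    ReducesStar R p p' ∧ IsIrreducible R p' ∧ ReducesStar R q q' ∧ IsIrreducible R q' ∧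
    (ρ = (p', q') ∧ List.Shortlex lt q' p' ∨ ρ = (q', p') ∧ List.Shortlex lt p' q')

/-- `R 0, R 1, R 2, …` are the systems obtained step by step in a run of the Knuth-Bendix
completion algorithm on `R₀`. Which critical pairs are treated at which step, and which
irreducible descendants are used, is left free; no rule is ever removed. -/
structure IsCompletionRun {A : Type*} (lt : A → A → Prop) (R₀ : RewritingSystem A)
    (R : ℕ → RewritingSystem A) : Prop where
  /-- the run starts from `R₀` -/
  zero : R 0 = R₀
  /-- each step only adds rules -/
  subset_succ : ∀ n, R n ⊆ R (n + 1)
  /-- every rule added is produced from a critical pair of the previous system -/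
  produced : ∀ n, ∀ ρ ∈ R (n + 1), ρ ∉ R n → IsProducedRule lt (R n) ρ
  /-- the algorithm is fair: no overlap is left aside forever, that is, the critical pair of each
  overlap that occurs is resolved by the rules obtained up to some step -/
  fair : ∀ n p q, IsOverlapPair (R n) p q → ∃ m, HaveCommonDescendant (R m) p q

/-- The system obtained from a completion run: the union of all its steps. -/
def limitSystem {A : Type*} (R : ℕ → RewritingSystem A) : RewritingSystem A := ⋃ n, R n

/-! ### Signed letters and positive words -/

/-- The alphabet `X ∪ X⁻¹`: `(a, true)` is the generator `a`, `(a, false)` its inverse. -/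
abbrev Letter (V : Type*) := V × Bool

/-- A word is positive if it contains no inverse of a generator. -/
def IsPositive {V : Type*} (w : List (Letter V)) : Prop := ∀ x ∈ w, x.2 = true

/-- The inclusion of the free monoid `X*` into the words on `X ∪ X⁻¹`. -/
def positiveWord {V : Type*} (w : FreeMonoid V) : List (Letter V) :=
  (FreeMonoid.toList w).map fun a => (a, true)

/-- `R⁺`: the rules of `R` with positive left-hand side. -/
def positivePart {V : Type*} (R : RewritingSystem (Letter V)) : RewritingSystem (Letter V) :=
  {ρ ∈ R | IsPositive ρ.1}

/-- Condition `C⁺`: each rule with positive left-hand side has a positive right-hand side. -/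
def SatisfiesCPlus {V : Type*} (R : RewritingSystem (Letter V)) : Prop :=
  ∀ ρ ∈ R, IsPositive ρ.1 → IsPositive ρ.2

/-- The factor monoid `X* / ≡_{R⁺}`, that is, `Mon⟨X ∣ R⁺⟩`. -/
abbrev PositiveFactorMonoid {V : Type*} (R : RewritingSystem (Letter V)) :=
  PresentedMonoid fun u v : FreeMonoid V => (positiveWord u, positiveWord v) ∈ positivePart R

/-! ### Right-angled Artin monoids -/

/-- The right-angled Artin monoid with defining graph `G`: one generator for each vertex and one
relation `ab = ba` for each edge `a - b`. -/
abbrev ArtinMonoid {V : Type*} (G : SimpleGraph V) :=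
  PresentedMonoid fun u v : FreeMonoid V => ∃ a b, G.Adj a b ∧
    u = FreeMonoid.of a * FreeMonoid.of b ∧ v = FreeMonoid.of b * FreeMonoid.of a

/-- `R⁺` is a rewriting system for the right-angled Artin monoid with defining graph `G`: all
rules of `R⁺` are rules between positive words, and the monoid is isomorphic to `X* / ≡_{R⁺}`, by
an isomorphism that fixes the generators. -/
def PositivePartPresentsArtinMonoid {V : Type*} (G : SimpleGraph V)
    (R : RewritingSystem (Letter V)) : Prop :=
  SatisfiesCPlus R ∧ ∃ e : ArtinMonoid G ≃* PositiveFactorMonoid R,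
    ∀ a : V, e (PresentedMonoid.of _ a) = PresentedMonoid.of _ a

/-- The order of the letters orients the four relations `a^ε b^δ = b^δ a^ε` of each edge `a - b`
in the same direction, whatever the signs. -/
def OrientsEdges {V : Type*} (G : SimpleGraph V) (lt : Letter V → Letter V → Prop) : Prop :=
  ∀ a b, G.Adj a b → ∀ ε δ ε' δ' : Bool, lt (a, ε) (b, δ) → lt (a, ε') (b, δ')

/-- The initial system for the right-angled Artin group with defining graph `G`: the rules
`a^ε b^δ → b^δ a^ε` for each edge `a - b` with `a^ε > b^δ`, and the rules of free reduction
`a a⁻¹ → 1` and `a⁻¹ a → 1`. -/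
def initialSystem {V : Type*} (G : SimpleGraph V) (lt : Letter V → Letter V → Prop) :
    RewritingSystem (Letter V) :=
  {ρ | (∃ (a b : V) (ε δ : Bool), G.Adj a b ∧ lt (b, δ) (a, ε) ∧
        ρ = ([(a, ε), (b, δ)], [(b, δ), (a, ε)])) ∨
      ∃ (a : V) (ε : Bool), ρ = ([(a, ε), (a, !ε)], [])}

end RightAngledArtin

/-! Confluence is not derived from the critical pair criterion. It follows from an explicit
description of the irreducible words: they are all normal, and each class of the congruence contains
only one normal word.

Uniqueness rests on the solution of the word problem in the group. Letters act on reduced words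
modulo commutation by left multiplication, and this action respects the defining relations, so
congruent reduced words differ only by commutations (`Congruent.traceEq`). Absence of bad factors
singles out one word in such a commutation class, and that word is the shortlex minimum of its
congruence class (`Normal.not_shortlex`).

The completion enters through `ResolvesOverlaps.exists_rule`. Take a bad factor `x w y` with `y <
x`, whose middle letters commute with `y` and are smaller than `y`. Resolving overlaps forces a rule
with exactly this left-hand side. A shortest bad factor is of this form or is `x x⁻¹`, so an
irreducible word has none.

The positive part needs no confluence, only that rules are decreasing consequences of the initial
system containing it. Exponent sums keep right-hand sides positive. Positive words are reduced, so
those congruent in the group are already equal in the monoid. This covers every finite step and the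
limit alike. -/

namespace RightAngledArtin

/-! ### Commuting letters and trace equivalence -/

section Trace

variable {V : Type*} {G : SimpleGraph V}

/-- The inverse letter. -/
def letterInv (x : Letter V) : Letter V := (x.1, !x.2)

@[simp] theorem letterInv_letterInv (x : Letter V) : letterInv (letterInv x) = x := by
  simp [letterInv]

/-- Two letters commute if their vertices are adjacent. -/
def Comm (G : SimpleGraph V) (x y : Letter V) : Prop := G.Adj x.1 y.1

theorem Comm.symm {x y : Letter V} (h : Comm G x y) : Comm G y x := G.adj_symm h

theorem Comm.ne {x y : Letter V} (h : Comm G x y) : x ≠ y := by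
  rintro rfl
  exact G.irrefl h

theorem Comm.ne_inv {x y : Letter V} (h : Comm G x y) : y ≠ letterInv x := by
  rintro rfl
  exact G.irrefl (v := x.1) h

@[simp] theorem comm_inv_left {x y : Letter V} : Comm G (letterInv x) y ↔ Comm G x y := Iff.rfl

@[simp] theorem comm_inv_right {x y : Letter V} : Comm G x (letterInv y) ↔ Comm G x y := Iff.rfl

/-- Equality of words in the partially commutative monoid on the signed letters. -/
inductive TraceEq (G : SimpleGraph V) : List (Letter V) → List (Letter V) → Prop
  | nil : TraceEq G [] []
  | cons (x : Letter V) {u v : List (Letter V)} : TraceEq G u v → TraceEq G (x :: u) (x :: v)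
  | swap {x y : Letter V} (u : List (Letter V)) : Comm G x y →
      TraceEq G (x :: y :: u) (y :: x :: u)
  | trans {u v w : List (Letter V)} : TraceEq G u v → TraceEq G v w → TraceEq G u w

theorem TraceEq.refl : ∀ u : List (Letter V), TraceEq G u u
  | [] => .nil
  | x :: u => .cons x (TraceEq.refl u)

theorem TraceEq.symm {u v : List (Letter V)} (h : TraceEq G u v) : TraceEq G v u := by
  induction h with
  | nil => exact .nil
  | cons x _ ih => exact .cons x ih
  | swap u h => exact .swap u h.symm
  | trans _ _ ih₁ ih₂ => exact ih₂.trans ih₁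

/-- `Lead G x u v`: the letter `x` can be moved to the front of `u`, leaving `v`. -/
inductive Lead (G : SimpleGraph V) (x : Letter V) : List (Letter V) → List (Letter V) → Prop
  | head (u : List (Letter V)) : Lead G x (x :: u) u
  | cons {z : Letter V} {u v : List (Letter V)} : Comm G x z → Lead G x u v →
      Lead G x (z :: u) (z :: v)

theorem Lead.traceEq {x : Letter V} {u v : List (Letter V)} (h : Lead G x u v) :
    TraceEq G u (x :: v) := by
  induction h with
  | head u => exact .refl _
  | cons hc _ ih => exact (TraceEq.cons _ ih).trans (.swap _ hc.symm)

theorem Lead.exists_append {x : Letter V} {u v : List (Letter V)} (h : Lead G x u v) :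
    ∃ p q, u = p ++ x :: q ∧ ∀ z ∈ p, Comm G x z := by
  induction h with
  | head u => exact ⟨[], u, rfl, by simp⟩
  | @cons z _ _ hc _ ih =>
    obtain ⟨p, q, rfl, hp⟩ := ih
    exact ⟨z :: p, q, rfl, List.forall_mem_cons.2 ⟨hc, hp⟩⟩

/-- Swapping two commuting letters never obstructs a third letter that passes both. Cancellation and
the invariance of `Reduced` rest on this. -/
theorem TraceEq.lead {x : Letter V} {u v : List (Letter V)} (h : TraceEq G u v) :
    ∀ {u'}, Lead G x u u' → ∃ v', Lead G x v v' ∧ TraceEq G u' v' := by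
  induction h with
  | nil => intro u' h; cases h
  | cons z huv ih =>
    intro u' h
    cases h with
    | head => exact ⟨_, .head _, huv⟩
    | cons hc h =>
      obtain ⟨v', hv, e⟩ := ih h
      exact ⟨_, .cons hc hv, .cons _ e⟩
  | swap u hab =>
    intro u' h
    cases h with
    | head => exact ⟨_, .cons hab (.head _), .refl _⟩
    | cons hc h =>
      cases h with
      | head => exact ⟨_, .head _, .refl _⟩
      | cons hd h => exact ⟨_, .cons hd (.cons hc h), .swap _ hab⟩
  | trans _ _ ih₁ ih₂ =>
    intro u' h
    obtain ⟨v', hv, e⟩ := ih₁ h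
    obtain ⟨w', hw, e'⟩ := ih₂ hv
    exact ⟨w', hw, e.trans e'⟩

/-- No letter commutes with itself, so only the first `x` can come to the front. This makes traces
left cancellative. -/
theorem Lead.of_cons_self {x : Letter V} {u v : List (Letter V)} (h : Lead G x (x :: u) v) :
    v = u := by
  cases h with
  | head => rfl
  | cons hc _ => exact absurd rfl hc.ne

theorem TraceEq.lead_of_cons {x : Letter V} {u v : List (Letter V)} (h : TraceEq G (x :: u) v) :
    ∃ v', Lead G x v v' ∧ TraceEq G u v' := h.lead (.head u)

theorem TraceEq.of_cons {x : Letter V} {u v : List (Letter V)}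
    (h : TraceEq G (x :: u) (x :: v)) : TraceEq G u v := by
  obtain ⟨v', hv, e⟩ := h.lead_of_cons
  rwa [hv.of_cons_self] at e

theorem Lead.unique {x : Letter V} {u v w : List (Letter V)} (h : Lead G x u v)
    (h' : Lead G x u w) : TraceEq G v w :=
  (h.traceEq.symm.trans h'.traceEq).of_cons

theorem Lead.tail {x y : Letter V} {u v : List (Letter V)} (h : Lead G y (x :: u) v)
    (hc : Comm G x y) : ∃ v', Lead G y u v' ∧ v = x :: v' := by
  cases h with
  | head => exact absurd rfl hc.ne
  | cons _ h => exact ⟨_, h, rfl⟩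

/-- A word is reduced if no letter cancels against a later one. -/
def Reduced (G : SimpleGraph V) : List (Letter V) → Prop
  | [] => True
  | x :: u => (¬ ∃ v, Lead G (letterInv x) u v) ∧ Reduced G u

theorem TraceEq.reduced {u v : List (Letter V)} (h : TraceEq G u v) :
    Reduced G u → Reduced G v := by
  induction h with
  | nil => exact id
  | cons x huv ih =>
    rintro ⟨h, hu⟩
    refine ⟨?_, ih hu⟩
    rintro ⟨w, hw⟩
    obtain ⟨w', hw', -⟩ := huv.symm.lead hw
    exact h ⟨w', hw'⟩
  | swap u hab =>
    rintro ⟨h₁, h₂, hu⟩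
    refine ⟨?_, ?_, hu⟩
    · rintro ⟨w, hw⟩
      obtain ⟨w', hw', -⟩ := hw.tail (comm_inv_right.2 hab)
      exact h₂ ⟨_, hw'⟩
    · rintro ⟨w, hw⟩
      exact h₁ ⟨_, .cons (comm_inv_left.2 hab) hw⟩
  | trans _ _ ih₁ ih₂ => exact ih₂ ∘ ih₁

/-! ### The action of the group on reduced words -/

open Classical in
/-- Left multiplication of a reduced word by a letter. -/
noncomputable def leftMul (G : SimpleGraph V) (x : Letter V) (u : List (Letter V)) :
    List (Letter V) :=
  if h : ∃ v, Lead G (letterInv x) u v then h.choose else x :: u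

/-- The remainder is chosen, but unique up to commutations; hence the group relations for `leftMul`
are stated as `TraceEq`. -/
theorem leftMul_of_lead {x : Letter V} {u v : List (Letter V)}
    (h : Lead G (letterInv x) u v) : TraceEq G (leftMul G x u) v := by
  have h' : ∃ v, Lead G (letterInv x) u v := ⟨v, h⟩
  rw [leftMul, dif_pos h']
  exact h'.choose_spec.unique h

theorem leftMul_of_not_lead {x : Letter V} {u : List (Letter V)}
    (h : ¬ ∃ v, Lead G (letterInv x) u v) : leftMul G x u = x :: u := dif_neg h

theorem TraceEq.leftMul_congr (x : Letter V) {u v : List (Letter V)} (h : TraceEq G u v) :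
    TraceEq G (leftMul G x u) (leftMul G x v) := by
  by_cases hu : ∃ w, Lead G (letterInv x) u w
  · obtain ⟨w, hw⟩ := hu
    obtain ⟨w', hw', e⟩ := h.lead hw
    exact (leftMul_of_lead hw).trans (e.trans (leftMul_of_lead hw').symm)
  · have hv : ¬ ∃ w, Lead G (letterInv x) v w := by
      rintro ⟨w, hw⟩
      obtain ⟨w', hw', -⟩ := h.symm.lead hw
      exact hu ⟨w', hw'⟩
    rw [leftMul_of_not_lead hu, leftMul_of_not_lead hv]
    exact .cons x h

theorem Reduced.reduced_leftMul (x : Letter V) {u : List (Letter V)} (h : Reduced G u) :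
    Reduced G (leftMul G x u) := by
  by_cases hu : ∃ w, Lead G (letterInv x) u w
  · obtain ⟨w, hw⟩ := hu
    exact (leftMul_of_lead hw).symm.reduced (hw.traceEq.reduced h).2
  · rw [leftMul_of_not_lead hu]
    exact ⟨hu, h⟩

theorem leftMul_leftMul_inv (x : Letter V) {u : List (Letter V)} (h : Reduced G u) :
    TraceEq G (leftMul G x (leftMul G (letterInv x) u)) u := by
  by_cases hu : ∃ w, Lead G (letterInv (letterInv x)) u w
  · obtain ⟨w, hw⟩ := hu
    -- Reducedness of `x w` says that `w` has no leading `x⁻¹`, so multiplying by `x` restores the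
    -- removed letter.
    have hr := hw.traceEq.reduced h
    rw [letterInv_letterInv] at hr
    refine ((leftMul_of_lead hw).leftMul_congr x).trans ?_
    rw [leftMul_of_not_lead hr.1]
    simpa using hw.traceEq.symm
  · rw [leftMul_of_not_lead hu]
    exact leftMul_of_lead (.head u)

theorem leftMul_comm {x y : Letter V} (hc : Comm G x y) (u : List (Letter V)) :
    TraceEq G (leftMul G x (leftMul G y u)) (leftMul G y (leftMul G x u)) := by
  -- Exactly one of the letters cancels. The letters are requantified so that both orders are
  -- covered.
  have mixed : ∀ {x y : Letter V}, Comm G x y → (∃ v, Lead G (letterInv x) u v) →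
      (¬ ∃ v, Lead G (letterInv y) u v) →
      TraceEq G (leftMul G x (leftMul G y u)) (leftMul G y (leftMul G x u)) := by
    rintro x y hc ⟨v, hv⟩ hy
    have hy' : ¬ ∃ w, Lead G (letterInv y) v w := by
      rintro ⟨w, hw⟩
      obtain ⟨w', hw', -⟩ := hv.traceEq.symm.lead (.cons (z := letterInv x) (comm_inv_left.2 (comm_inv_right.2 hc.symm)) hw)
      exact hy ⟨w', hw'⟩
    have h₁ := (leftMul_of_lead hv).leftMul_congr y
    rw [leftMul_of_not_lead hy'] at h₁
    rw [leftMul_of_not_lead hy]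
    exact (leftMul_of_lead (.cons hc hv)).trans h₁.symm
  by_cases hx : ∃ v, Lead G (letterInv x) u v <;> by_cases hy : ∃ v, Lead G (letterInv y) u v
  · obtain ⟨v, hv⟩ := hx
    obtain ⟨w, hw⟩ := hy
    obtain ⟨t, ht, e⟩ := hv.traceEq.lead hw
    obtain ⟨t, ht', rfl⟩ := ht.tail (comm_inv_left.2 (comm_inv_right.2 hc))
    obtain ⟨s, hs, e'⟩ := e.symm.lead_of_cons
    exact (((leftMul_of_lead hw).leftMul_congr x).trans (leftMul_of_lead hs)).trans
      (e'.symm.trans (((leftMul_of_lead hv).leftMul_congr y).trans (leftMul_of_lead ht')).symm)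
  · exact mixed hc hx hy
  · exact (mixed hc.symm hy hx).symm
  · rw [leftMul_of_not_lead hx, leftMul_of_not_lead hy, leftMul_of_not_lead,
      leftMul_of_not_lead]
    · exact .swap u hc
    · rintro ⟨v, hv⟩
      obtain ⟨v', hv', -⟩ := hv.tail (comm_inv_right.2 hc)
      exact hy ⟨v', hv'⟩
    · rintro ⟨v, hv⟩
      obtain ⟨v', hv', -⟩ := hv.tail (comm_inv_right.2 hc.symm)
      exact hx ⟨v', hv'⟩

/-- Left multiplication of a reduced word by a word. -/
noncomputable def wordMul (G : SimpleGraph V) (w u : List (Letter V)) : List (Letter V) :=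
  w.foldr (leftMul G) u

theorem wordMul_append (w w' u : List (Letter V)) :
    wordMul G (w ++ w') u = wordMul G w (wordMul G w' u) := List.foldr_append

theorem TraceEq.wordMul_congr (w : List (Letter V)) {u v : List (Letter V)} (h : TraceEq G u v) :
    TraceEq G (wordMul G w u) (wordMul G w v) := by
  induction w with
  | nil => exact h
  | cons x w ih => exact ih.leftMul_congr x

theorem Reduced.reduced_wordMul (w : List (Letter V)) {u : List (Letter V)} (h : Reduced G u) :
    Reduced G (wordMul G w u) := by
  induction w with
  | nil => exact h
  | cons x w ih => exact ih.reduced_leftMul x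

theorem Reduced.wordMul_nil {u : List (Letter V)} (h : Reduced G u) : wordMul G u [] = u := by
  induction u with
  | nil => rfl
  | cons x u ih =>
    change leftMul G x (wordMul G u []) = x :: u
    rw [ih h.2, leftMul_of_not_lead h.1]

theorem Congruent.wordMul_traceEq {lt : Letter V → Letter V → Prop} {u v : List (Letter V)}
    (h : Congruent (initialSystem G lt) u v) :
    TraceEq G (wordMul G u []) (wordMul G v []) := by
  induction h with
  | rel u v h =>
    obtain ⟨s, t, l, r, hlr, rfl, rfl⟩ := h
    have ht : Reduced G (wordMul G t []) := Reduced.reduced_wordMul (u := []) t trivial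
    simp only [wordMul_append]
    rw [← wordMul_append, wordMul_append]
    refine TraceEq.wordMul_congr s ?_
    rcases hlr with ⟨a, b, ε, δ, hab, -, e⟩ | ⟨a, ε, e⟩
    · obtain ⟨rfl, rfl⟩ := Prod.mk.inj e
      exact leftMul_comm (x := (a, ε)) (y := (b, δ)) hab _
    · obtain ⟨rfl, rfl⟩ := Prod.mk.inj e
      exact leftMul_leftMul_inv (a, ε) ht
  | refl u => exact .refl _
  | symm _ _ _ ih => exact ih.symm
  | trans _ _ _ _ _ ih₁ ih₂ => exact ih₁.trans ih₂

/-- Van der Waerden's argument: a reduced word is recovered from its action on the empty word. -/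
theorem Congruent.traceEq {lt : Letter V → Letter V → Prop} {u v : List (Letter V)}
    (h : Congruent (initialSystem G lt) u v) (hu : Reduced G u) (hv : Reduced G v) :
    TraceEq G u v := by
  simpa only [hu.wordMul_nil, hv.wordMul_nil] using h.wordMul_traceEq

end Trace

/-! ### General facts on rewriting systems -/

section Rewriting

variable {A : Type*} {R S : RewritingSystem A}

theorem Reduces.of_mem {l r : List A} (h : (l, r) ∈ R) : Reduces R l r :=
  ⟨[], [], l, r, h, by simp, by simp⟩

theorem Reduces.mono (h : R ⊆ S) {u v : List A} : Reduces R u v → Reduces S u v := by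
  rintro ⟨s, t, l, r, hlr, rfl, rfl⟩
  exact ⟨s, t, l, r, h hlr, rfl, rfl⟩

theorem ReducesStar.mono (h : R ⊆ S) {u v : List A} : ReducesStar R u v → ReducesStar S u v :=
  Relation.ReflTransGen.mono (fun _ _ => Reduces.mono h) _ _

theorem Reduces.append {u v : List A} (h : Reduces R u v) (p q : List A) :
    Reduces R (p ++ u ++ q) (p ++ v ++ q) := by
  obtain ⟨s, t, l, r, hlr, rfl, rfl⟩ := h
  exact ⟨p ++ s, t ++ q, l, r, hlr, by simp, by simp⟩

theorem Congruent.refl (u : List A) : Congruent R u u := Relation.EqvGen.refl u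

theorem Congruent.symm {u v : List A} (h : Congruent R u v) : Congruent R v u :=
  Relation.EqvGen.symm _ _ h

theorem Congruent.trans {u v w : List A} (h : Congruent R u v) (h' : Congruent R v w) :
    Congruent R u w := Relation.EqvGen.trans _ _ _ h h'

theorem Congruent.of_mem {l r : List A} (h : (l, r) ∈ R) : Congruent R l r :=
  Relation.EqvGen.rel _ _ (.of_mem h)

theorem Congruent.append {u v : List A} (h : Congruent R u v) (p q : List A) :
    Congruent R (p ++ u ++ q) (p ++ v ++ q) := by
  induction h with
  | rel u v h => exact .rel _ _ (h.append p q)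
  | refl u => exact .refl _
  | symm _ _ _ ih => exact ih.symm
  | trans _ _ _ _ _ ih₁ ih₂ => exact ih₁.trans ih₂

theorem Congruent.append_left {u v : List A} (h : Congruent R u v) (p : List A) :
    Congruent R (p ++ u) (p ++ v) := by simpa using h.append p []

theorem Congruent.append_right {u v : List A} (h : Congruent R u v) (q : List A) :
    Congruent R (u ++ q) (v ++ q) := h.append [] q

theorem Congruent.of_rules (h : ∀ ρ ∈ R, Congruent S ρ.1 ρ.2) {u v : List A}
    (huv : Congruent R u v) : Congruent S u v := by
  induction huv with
  | rel u v huv =>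
    obtain ⟨s, t, l, r, hlr, rfl, rfl⟩ := huv
    exact (h _ hlr).append s t
  | refl u => exact .refl _
  | symm _ _ _ ih => exact ih.symm
  | trans _ _ _ _ _ ih₁ ih₂ => exact ih₁.trans ih₂

theorem ReducesStar.congruent {u v : List A} (h : ReducesStar R u v) : Congruent R u v := by
  induction h with
  | refl => exact .refl _
  | tail _ h ih => exact ih.trans (.rel _ _ h)

theorem IsOverlapPair.congruent {p q : List A} (h : IsOverlapPair R p q) : Congruent R p q := by
  obtain ⟨u, v, w, r₁, r₂, -, -, -, h₁, h₂, rfl, rfl⟩ := h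
  have h₁' := (Congruent.of_mem h₁).append_right w
  have h₂' := (Congruent.of_mem h₂).append_left u
  rw [← List.append_assoc] at h₂'
  exact h₁'.symm.trans h₂'

theorem IsInclusionPair.congruent {p q : List A} (h : IsInclusionPair R p q) :
    Congruent R p q := by
  obtain ⟨u, v, w, r₁, r₂, -, h₁, h₂, rfl, rfl⟩ := h
  exact ((Congruent.of_mem h₁).append u w).symm.trans (.of_mem h₂)

theorem IsProducedRule.congruent {lt : A → A → Prop} {ρ : List A × List A}
    (h : IsProducedRule lt R ρ) : Congruent R ρ.1 ρ.2 := by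
  obtain ⟨p, q, p', q', hpq, hp, -, hq, -, h⟩ := h
  have e : Congruent R p' q' := hp.congruent.symm.trans
    ((hpq.elim IsOverlapPair.congruent IsInclusionPair.congruent).trans hq.congruent)
  rcases h with ⟨rfl, -⟩ | ⟨rfl, -⟩
  exacts [e, e.symm]

theorem IsProducedRule.shortlex {lt : A → A → Prop} {ρ : List A × List A}
    (h : IsProducedRule lt R ρ) : List.Shortlex lt ρ.2 ρ.1 := by
  obtain ⟨p, q, p', q', -, -, -, -, -, ⟨rfl, h⟩ | ⟨rfl, h⟩⟩ := h
  exacts [h, h]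

/-- All rules decrease the length-lexicographical order. -/
def IsDecreasing (lt : A → A → Prop) (R : RewritingSystem A) : Prop :=
  ∀ ρ ∈ R, List.Shortlex lt ρ.2 ρ.1

variable {lt : A → A → Prop}

theorem shortlex_append_right {u v : List A} (h : List.Shortlex lt u v) (w : List A) :
    List.Shortlex lt (u ++ w) (v ++ w) := by
  -- Equal length excludes a proper prefix, for which appending on the right could reverse the
  -- lexicographical order.
  have key : ∀ {u v : List A}, u.length = v.length → List.Lex lt u v →
      List.Lex lt (u ++ w) (v ++ w) := by
    intro u v hl h
    induction h with
    | nil => simp at hl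
    | cons _ ih => exact .cons (ih (by simpa using hl))
    | rel h => exact .rel h
  rcases List.shortlex_def.1 h with h | ⟨hl, h⟩
  · exact .of_length_lt (by simpa using h)
  · exact .of_lex (by simpa using hl) (key hl h)

theorem Reduces.shortlex (hR : IsDecreasing lt R) {u v : List A} (h : Reduces R u v) :
    List.Shortlex lt v u := by
  obtain ⟨s, t, l, r, hlr, rfl, rfl⟩ := h
  exact shortlex_append_right ((hR _ hlr).append_left s) t

theorem shortlex_trans [IsTrans A lt] {u v w : List A} (h : List.Shortlex lt u v)
    (h' : List.Shortlex lt v w) : List.Shortlex lt u w := by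
  have key : ∀ {u v w : List A}, List.Lex lt u v → List.Lex lt v w → List.Lex lt u w := by
    intro u v w h
    induction h generalizing w with
    | nil => intro h'; cases h' <;> exact .nil
    | cons _ ih =>
      intro h'
      cases h' with
      | cons h' => exact .cons (ih h')
      | rel h' => exact .rel h'
    | rel h =>
      intro h'
      cases h' with
      | cons h' => exact .rel h
      | rel h' => exact .rel (_root_.trans h h')
  rw [List.shortlex_def] at *
  rcases h with h | ⟨hl, h⟩ <;> rcases h' with h' | ⟨hl', h'⟩
  · exact .inl (h.trans h')
  · exact .inl (hl' ▸ h)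
  · exact .inl (hl ▸ h')
  · exact .inr ⟨hl.trans hl', key h h'⟩

theorem ReducesStar.eq_or_shortlex [IsTrans A lt] (hR : IsDecreasing lt R) {u v : List A}
    (h : ReducesStar R u v) : v = u ∨ List.Shortlex lt v u := by
  induction h with
  | refl => exact .inl rfl
  | tail _ h ih =>
    have h := h.shortlex hR
    rcases ih with rfl | ih
    exacts [.inr h, .inr (shortlex_trans h ih)]

theorem ReducesStar.eq_of_isIrreducible {u v : List A} (hu : IsIrreducible R u)
    (h : ReducesStar R u v) : v = u := by
  rcases h.cases_head with h | ⟨w, hw, -⟩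
  exacts [h.symm, absurd ⟨w, hw⟩ hu]

theorem IsDecreasing.exists_irreducible (hwf : WellFounded lt) (hR : IsDecreasing lt R)
    (u : List A) : ∃ v, ReducesStar R u v ∧ IsIrreducible R v := by
  induction u using (List.Shortlex.wf hwf).induction with
  | _ u ih =>
    by_cases hu : ∃ v, Reduces R u v
    · obtain ⟨v, hv⟩ := hu
      obtain ⟨w, hw, hi⟩ := ih v (hv.shortlex hR)
      exact ⟨w, hw.head hv, hi⟩
    · exact ⟨u, .refl, hu⟩

theorem IsDecreasing.isTerminating (hwf : WellFounded lt) (hR : IsDecreasing lt R) :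
    IsTerminating R := by
  rintro ⟨w, hw⟩
  exact (wellFounded_iff_isEmpty_descending_chain.1 (List.Shortlex.wf hwf)).false
    ⟨w, fun n => (hw n).shortlex hR⟩

end Rewriting

/-! ### Runs of the completion algorithm -/

section Completion

variable {A : Type*} {lt : A → A → Prop} {R₀ : RewritingSystem A} {R : ℕ → RewritingSystem A}

theorem IsCompletionRun.monotone (h : IsCompletionRun lt R₀ R) : Monotone R :=
  monotone_nat_of_le_succ h.subset_succ

theorem IsCompletionRun.isDecreasing (h : IsCompletionRun lt R₀ R) (h₀ : IsDecreasing lt R₀)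
    (n : ℕ) : IsDecreasing lt (R n) := by
  induction n with
  | zero => rwa [h.zero]
  | succ n ih =>
    intro ρ hρ
    by_cases hn : ρ ∈ R n
    exacts [ih ρ hn, (h.produced n ρ hρ hn).shortlex]

theorem IsCompletionRun.congruent (h : IsCompletionRun lt R₀ R) (n : ℕ) :
    ∀ ρ ∈ R n, Congruent R₀ ρ.1 ρ.2 := by
  induction n with
  | zero => rw [h.zero]; exact fun ρ hρ => .of_mem hρ
  | succ n ih =>
    intro ρ hρ
    by_cases hn : ρ ∈ R n
    exacts [ih ρ hn, .of_rules ih (h.produced n ρ hρ hn).congruent]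

theorem IsCompletionRun.limitSystem_isDecreasing (h : IsCompletionRun lt R₀ R)
    (h₀ : IsDecreasing lt R₀) : IsDecreasing lt (limitSystem R) := by
  intro ρ hρ
  obtain ⟨n, hn⟩ := Set.mem_iUnion.1 hρ
  exact h.isDecreasing h₀ n ρ hn

theorem IsCompletionRun.limitSystem_congruent (h : IsCompletionRun lt R₀ R) :
    ∀ ρ ∈ limitSystem R, Congruent R₀ ρ.1 ρ.2 := by
  intro ρ hρ
  obtain ⟨n, hn⟩ := Set.mem_iUnion.1 hρ
  exact h.congruent n ρ hn

theorem IsCompletionRun.subset_limitSystem (h : IsCompletionRun lt R₀ R) :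
    R₀ ⊆ limitSystem R :=
  h.zero ▸ Set.subset_iUnion R 0

theorem IsCompletionRun.limitSystem_areEquivalent (h : IsCompletionRun lt R₀ R) :
    AreEquivalent (limitSystem R) R₀ := fun _ _ =>
  ⟨.of_rules h.limitSystem_congruent, .of_rules fun _ hρ => .of_mem (h.subset_limitSystem hρ)⟩

/-- The run that adds, at each step, all the rules that can be produced. -/
def exhaustiveRun (lt : A → A → Prop) (R₀ : RewritingSystem A) : ℕ → RewritingSystem A
  | 0 => R₀
  | n + 1 => exhaustiveRun lt R₀ n ∪ {ρ | IsProducedRule lt (exhaustiveRun lt R₀ n) ρ}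

theorem exhaustiveRun_isCompletionRun [Std.Trichotomous lt] (hwf : WellFounded lt)
    (h₀ : IsDecreasing lt R₀) : IsCompletionRun lt R₀ (exhaustiveRun lt R₀) := by
  have hdec : ∀ n, IsDecreasing lt (exhaustiveRun lt R₀ n) := by
    intro n
    induction n with
    | zero => exact h₀
    | succ n ih =>
      rintro ρ (hρ | hρ)
      exacts [ih ρ hρ, hρ.shortlex]
  refine ⟨rfl, fun n => Set.subset_union_left, fun n ρ hρ hn => hρ.resolve_left hn, ?_⟩
  intro n p q hpq
  obtain ⟨p', hp, hp'⟩ := (hdec n).exists_irreducible hwf p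
  obtain ⟨q', hq, hq'⟩ := (hdec n).exists_irreducible hwf q
  have hsub : exhaustiveRun lt R₀ n ⊆ exhaustiveRun lt R₀ (n + 1) := Set.subset_union_left
  have hmem : ∀ ρ, IsProducedRule lt (exhaustiveRun lt R₀ n) ρ →
      ρ ∈ exhaustiveRun lt R₀ (n + 1) := fun ρ hρ => .inr hρ
  refine ⟨n + 1, ?_⟩
  by_cases h : List.Shortlex lt q' p'
  · exact ⟨q', (hp.mono hsub).tail (.of_mem (hmem _ ⟨p, q, p', q', .inl hpq, hp, hp', hq, hq',
      .inl ⟨rfl, h⟩⟩)), hq.mono hsub⟩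
  by_cases h' : List.Shortlex lt p' q'
  · exact ⟨p', hp.mono hsub, (hq.mono hsub).tail (.of_mem (hmem _ ⟨p, q, p', q', .inl hpq, hp,
      hp', hq, hq', .inr ⟨rfl, h'⟩⟩))⟩
  obtain rfl : p' = q' := Std.Trichotomous.trichotomous (r := List.Shortlex lt) _ _ h' h
  exact ⟨p', hp.mono hsub, hq.mono hsub⟩

end Completion

/-! ### Normal words -/

section Normal

variable {V : Type*} {G : SimpleGraph V} {lt : Letter V → Letter V → Prop}

theorem TraceEq.length_eq {u v : List (Letter V)} (h : TraceEq G u v) :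
    u.length = v.length := by
  induction h with
  | nil => rfl
  | cons x _ ih => simp [ih]
  | swap u _ => simp
  | trans _ _ ih₁ ih₂ => exact ih₁.trans ih₂

/-- In the word `x w y`, the letter `y` can be moved next to `x`, where it cancels or forms a
decreasing pair of commuting letters. -/
def IsBad (G : SimpleGraph V) (lt : Letter V → Letter V → Prop) (x : Letter V)
    (w : List (Letter V)) (y : Letter V) : Prop :=
  (Comm G y x ∧ lt y x ∨ y = letterInv x) ∧ ∀ z ∈ w, Comm G y z

/-- Words without bad factor. -/
def Normal (G : SimpleGraph V) (lt : Letter V → Letter V → Prop) (s : List (Letter V)) : Prop :=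
  ∀ x w y, x :: (w ++ [y]) <:+: s → ¬ IsBad G lt x w y

theorem Normal.of_infix {s t : List (Letter V)} (h : Normal G lt s) (hts : t <:+: s) :
    Normal G lt t := fun x w y hi => h x w y (hi.trans hts)

theorem Normal.of_cons {x : Letter V} {s : List (Letter V)} (h : Normal G lt (x :: s)) :
    Normal G lt s := h.of_infix (List.suffix_cons x s).isInfix

theorem Normal.reduced {s : List (Letter V)} (h : Normal G lt s) : Reduced G s := by
  induction s with
  | nil => trivial
  | cons x s ih =>
    refine ⟨?_, ih h.of_cons⟩
    rintro ⟨v, hv⟩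
    obtain ⟨p, q, rfl, hp⟩ := hv.exists_append
    exact h x p _ ⟨[], q, by simp⟩ ⟨.inr rfl, hp⟩

theorem Comm.mem_initialSystem {x y : Letter V} (h : Comm G x y) (hlt : lt y x) :
    ([x, y], [y, x]) ∈ initialSystem G lt :=
  .inl ⟨x.1, y.1, x.2, y.2, h, hlt, rfl⟩

theorem letterInv_mem_initialSystem (x : Letter V) :
    ([x, letterInv x], []) ∈ initialSystem G lt :=
  .inr ⟨x.1, x.2, rfl⟩

theorem initialSystem_isDecreasing : IsDecreasing lt (initialSystem G lt) := by
  rintro ρ (⟨a, b, ε, δ, -, h, rfl⟩ | ⟨a, ε, rfl⟩)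
  · exact .of_lex rfl (.rel h)
  · exact .of_length_lt (by simp)

variable [IsStrictTotalOrder (Letter V) lt]

theorem Normal.not_lt_of_traceEq {x y : Letter V} {u v : List (Letter V)}
    (hv : Normal G lt (y :: v)) (h : TraceEq G (x :: u) (y :: v)) : ¬ lt x y := by
  intro hxy
  obtain ⟨w, hw, -⟩ := h.lead_of_cons
  cases hw with
  | head => exact irrefl_of lt x hxy
  | cons hc hw =>
    obtain ⟨p, q, rfl, hp⟩ := hw.exists_append
    exact hv y p x ⟨[], q, by simp⟩ ⟨.inl ⟨hc, hxy⟩, hp⟩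

theorem Normal.eq_of_traceEq {u v : List (Letter V)} (hu : Normal G lt u)
    (hv : Normal G lt v) (h : TraceEq G u v) : u = v := by
  induction u generalizing v with
  | nil => exact (List.length_eq_zero_iff.1 h.length_eq.symm).symm
  | cons x u ih =>
    cases v with
    | nil => simpa using h.length_eq
    | cons y v =>
      obtain rfl : x = y := Std.Trichotomous.trichotomous (r := lt) _ _
        (hv.not_lt_of_traceEq h) (hu.not_lt_of_traceEq h.symm)
      rw [ih hu.of_cons hv.of_cons h.of_cons]

theorem Normal.eq_of_congruent {u v : List (Letter V)} (hu : Normal G lt u)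
    (hv : Normal G lt v) (h : Congruent (initialSystem G lt) u v) : u = v :=
  hu.eq_of_traceEq hv (h.traceEq hu.reduced hv.reduced)

theorem Comm.congruent {x y : Letter V} (h : Comm G x y) :
    Congruent (initialSystem G lt) [x, y] [y, x] := by
  rcases trichotomous_of lt x y with hlt | rfl | hlt
  · exact (Congruent.of_mem (h.symm.mem_initialSystem hlt)).symm
  · exact .refl _
  · exact .of_mem (h.mem_initialSystem hlt)

theorem congruent_move {y : Letter V} {w : List (Letter V)} (h : ∀ z ∈ w, Comm G y z) :
    Congruent (initialSystem G lt) (w ++ [y]) (y :: w) := by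
  induction w with
  | nil => exact .refl _
  | cons z w ih =>
    rw [List.forall_mem_cons] at h
    have h₁ := (ih h.2).append_left [z]
    have h₂ := (h.1.symm.congruent (lt := lt)).append_right w
    exact h₁.trans h₂

theorem IsBad.exists_smaller {x y : Letter V} {w : List (Letter V)} (h : IsBad G lt x w y) :
    ∃ t, Congruent (initialSystem G lt) (x :: (w ++ [y])) t ∧
      List.Shortlex lt t (x :: (w ++ [y])) := by
  obtain ⟨h, hw⟩ := h
  have hm := (congruent_move (lt := lt) hw).append_left [x]
  rcases h with ⟨hc, hlt⟩ | rfl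
  · exact ⟨y :: x :: w, hm.trans ((hc.symm.congruent (lt := lt)).append_right w),
      .of_lex (by simp) (.rel hlt)⟩
  · exact ⟨w, hm.trans ((Congruent.of_mem (letterInv_mem_initialSystem x)).append_right w),
      .of_length_lt (by simp)⟩

theorem exists_normal (hwf : WellFounded lt) (u : List (Letter V)) :
    ∃ v, Normal G lt v ∧ Congruent (initialSystem G lt) u v ∧
      (v = u ∨ List.Shortlex lt v u) := by
  induction u using (List.Shortlex.wf hwf).induction with
  | _ u ih =>
    by_cases hu : Normal G lt u
    · exact ⟨u, hu, .refl _, .inl rfl⟩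
    · simp only [Normal, not_forall, not_not] at hu
      obtain ⟨x, w, y, ⟨p, q, rfl⟩, hb⟩ := hu
      obtain ⟨t, ht, hlt⟩ := hb.exists_smaller
      have hlt' := shortlex_append_right (hlt.append_left p) q
      obtain ⟨v, hv, hvt, h⟩ := ih _ hlt'
      refine ⟨v, hv, (ht.append p q).trans hvt, .inr ?_⟩
      rcases h with rfl | h
      exacts [hlt', shortlex_trans h hlt']

theorem Normal.not_shortlex (hwf : WellFounded lt) {s t : List (Letter V)}
    (hs : Normal G lt s) (h : Congruent (initialSystem G lt) s t) :
    ¬ List.Shortlex lt t s := by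
  intro hlt
  obtain ⟨v, hv, htv, h'⟩ := exists_normal (G := G) hwf t
  obtain rfl := hs.eq_of_congruent hv (h.trans htv)
  rcases h' with rfl | h'
  exacts [asymm_of _ hlt hlt, asymm_of _ hlt h']

theorem Normal.append_singleton {y : Letter V} {w : List (Letter V)} (h : Normal G lt w)
    (hw : ∀ z ∈ w, Comm G y z ∧ lt z y) : Normal G lt (w ++ [y]) := by
  intro x v y' hi hb
  rw [List.infix_concat_iff] at hi
  rcases hi with hi | hi
  · have hi' : (x :: v) ++ [y'] <:+ w ++ [y] := by simpa using hi
    obtain ⟨p, hp⟩ := hi'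
    rw [← List.append_assoc] at hp
    obtain ⟨rfl, h₂⟩ := List.append_inj' hp rfl
    obtain rfl := List.singleton_injective h₂
    obtain ⟨hc, hlt⟩ := hw x (by simp)
    rcases hb.1 with ⟨-, h⟩ | h
    · exact asymm_of lt hlt h
    · exact hc.symm.ne_inv h
  · exact h x v y' hi hb

end Normal

/-! ### Confluence -/

section Confluence

variable {V : Type*} {G : SimpleGraph V} {lt : Letter V → Letter V → Prop}

theorem Congruent.of_cons {x : Letter V} {u v : List (Letter V)}
    (h : Congruent (initialSystem G lt) (x :: u) (x :: v)) :
    Congruent (initialSystem G lt) u v := by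
  have hx : Congruent (initialSystem G lt) [letterInv x, x] [] := by
    simpa using Congruent.of_mem (letterInv_mem_initialSystem (G := G) (lt := lt) (letterInv x))
  exact (hx.append_right u).symm.trans ((h.append_left [letterInv x]).trans (hx.append_right v))

theorem infix_cons_concat_cases {A : Type*} {x y : A} {l m : List A}
    (h : l <:+: x :: (m ++ [y])) : l = x :: (m ++ [y]) ∨ l <:+: x :: m ∨ l <:+: m ++ [y] := by
  rw [List.infix_cons_iff] at h
  rcases h with h | h
  · rw [← List.cons_append, List.prefix_concat_iff] at h
    exact h.imp id fun h => .inl h.isInfix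
  · exact .inr (.inr h)

/-- The initial system is enlarged to `S` by decreasing consequences, and all overlaps of `S` are
resolved. -/
structure ResolvesOverlaps (G : SimpleGraph V) (lt : Letter V → Letter V → Prop)
    (S : RewritingSystem (Letter V)) : Prop where
  initial_subset : initialSystem G lt ⊆ S
  decreasing : IsDecreasing lt S
  congruent : ∀ ρ ∈ S, Congruent (initialSystem G lt) ρ.1 ρ.2
  overlap : ∀ p q, IsOverlapPair S p q → HaveCommonDescendant S p q

theorem IsCompletionRun.resolvesOverlaps {R : ℕ → RewritingSystem (Letter V)}
    (h : IsCompletionRun lt (initialSystem G lt) R) : ResolvesOverlaps G lt (limitSystem R) where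
  initial_subset := h.subset_limitSystem
  decreasing := h.limitSystem_isDecreasing initialSystem_isDecreasing
  congruent := h.limitSystem_congruent
  overlap := by
    rintro p q ⟨u, v, w, r₁, r₂, hu, hv, hw, h₁, h₂, hp, hq⟩
    obtain ⟨m, hm⟩ := Set.mem_iUnion.1 h₁
    obtain ⟨n, hn⟩ := Set.mem_iUnion.1 h₂
    obtain ⟨k, z, hpz, hqz⟩ := h.fair (max m n) p q ⟨u, v, w, r₁, r₂, hu, hv, hw,
      h.monotone (le_max_left m n) hm, h.monotone (le_max_right m n) hn, hp, hq⟩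
    exact ⟨z, hpz.mono (Set.subset_iUnion R k), hqz.mono (Set.subset_iUnion R k)⟩

variable [IsStrictTotalOrder (Letter V) lt] {S : RewritingSystem (Letter V)}

theorem ResolvesOverlaps.not_normal (hS : ResolvesOverlaps G lt S) (hwf : WellFounded lt)
    {l r : List (Letter V)} (h : (l, r) ∈ S) : ¬ Normal G lt l :=
  fun hl => hl.not_shortlex hwf (hS.congruent _ h) (hS.decreasing _ h)

theorem ResolvesOverlaps.shortlex_append (hS : ResolvesOverlaps G lt S) (hwf : WellFounded lt)
    {x y z : Letter V} {w r : List (Letter V)} (hr : (x :: (w ++ [y]), r) ∈ S)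
    (hw : Normal G lt (w ++ [y])) :
    List.Shortlex lt (r ++ [z]) (x :: w ++ [z, y]) := by
  have hc := hS.congruent _ hr
  rcases List.shortlex_def.1 (hS.decreasing _ hr) with hl | ⟨hl, h⟩
  · exact .of_length_lt (by simpa using hl)
  · cases h with
    | nil => simp at hl
    | rel h => exact .of_lex (by simpa using hl) (.rel h)
    | cons h =>
      exact absurd (List.Shortlex.of_lex (by simpa using hl) h)
        (hw.not_shortlex hwf hc.of_cons)

theorem ResolvesOverlaps.exists_rule (hS : ResolvesOverlaps G lt S) (hwf : WellFounded lt)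
    {x y : Letter V} (hc : Comm G y x) (hlt : lt y x) (w : List (Letter V))
    (hw : ∀ z ∈ w, Comm G y z ∧ lt z y) (hn : Normal G lt (x :: w)) :
    ∃ r, (x :: (w ++ [y]), r) ∈ S := by
  induction w using List.reverseRecOn with
  | nil => exact ⟨_, hS.initial_subset (hc.symm.mem_initialSystem hlt)⟩
  | append_singleton w z ih =>
    have hw' : ∀ z ∈ w, Comm G y z ∧ lt z y := fun t ht => hw t (by simp [ht])
    have hn' : Normal G lt (x :: w) := hn.of_infix ⟨[], [z], by simp⟩
    obtain ⟨r, hr⟩ := ih hw' hn'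
    by_contra! hno
    have hz := hw z (by simp)
    have hirr : IsIrreducible S (x :: w ++ [z, y]) := by
      rintro ⟨t, a, b, l, r', hlr, hl, -⟩
      have hi : l <:+: x :: ((w ++ [z]) ++ [y]) := ⟨a, b, by simpa using hl.symm⟩
      rcases infix_cons_concat_cases hi with rfl | hi | hi
      · exact hno _ hlr
      · exact hS.not_normal hwf hlr (hn.of_infix hi)
      · exact hS.not_normal hwf hlr ((hn.of_cons.append_singleton hw).of_infix hi)
    obtain ⟨t, hp, hq⟩ := hS.overlap (r ++ [z]) (x :: w ++ [z, y])
      ⟨x :: w, [y], [z], r, [z, y], by simp, by simp, by simp, hr,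
        hS.initial_subset (hz.1.mem_initialSystem hz.2), rfl, rfl⟩
    obtain rfl := hq.eq_of_isIrreducible hirr
    have hs := hS.shortlex_append hwf (z := z) hr (hn'.of_cons.append_singleton hw')
    rcases hp.eq_or_shortlex hS.decreasing with h | h
    · rw [h] at hs
      exact asymm_of _ hs hs
    · exact asymm_of _ hs h

theorem ResolvesOverlaps.normal_of_isIrreducible (hS : ResolvesOverlaps G lt S)
    (hwf : WellFounded lt) (hlt : OrientsEdges G lt) {s : List (Letter V)}
    (hs : IsIrreducible S s) : Normal G lt s := by
  have hrule : ∀ l r, (l, r) ∈ S → ¬ l <:+: s := by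
    rintro l r hlr ⟨p, q, rfl⟩
    exact hs ⟨_, p, q, l, r, hlr, rfl, rfl⟩
  suffices H : ∀ n, ∀ x w y, w.length = n → x :: (w ++ [y]) <:+: s → ¬ IsBad G lt x w y from
    fun x w y => H _ x w y rfl
  intro n
  induction n using Nat.strong_induction_on with
  | _ n ih =>
    rintro x w y rfl hi ⟨hb, hw⟩
    have hn : ∀ {t : List (Letter V)}, t <:+: x :: (w ++ [y]) → t.length ≤ w.length + 1 →
        Normal G lt t := by
      intro t ht hlen x' w' y' hi'
      have := hi'.length_le
      refine ih _ ?_ x' w' y' rfl (hi'.trans (ht.trans hi))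
      simp at this
      omega
    have hn₁ : Normal G lt (x :: w) := hn ⟨[], [y], by simp⟩ (by simp)
    have hn₂ : Normal G lt (w ++ [y]) := hn (List.suffix_cons _ _).isInfix (by simp)
    rcases hb with ⟨hc, hyx⟩ | rfl
    · have hw' : ∀ z ∈ w, Comm G y z ∧ lt z y := by
        intro z hz
        refine ⟨hw z hz, ?_⟩
        rcases trichotomous_of lt z y with h | rfl | h
        · exact h
        · exact absurd rfl (hw z hz).ne
        · obtain ⟨a, b, rfl⟩ := List.append_of_mem hz
          exact absurd ⟨.inl ⟨hw z hz, h⟩, fun t ht => hw t (by simp [ht])⟩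
            (hn₂ z b y ⟨a, [], by simp⟩)
      obtain ⟨r, hr⟩ := hS.exists_rule hwf hc hyx w hw' hn₁
      exact hrule _ _ hr hi
    · cases w with
      | nil => exact hrule _ _ (hS.initial_subset (letterInv_mem_initialSystem x)) hi
      | cons z w =>
        rw [List.forall_mem_cons] at hw
        have hxz : Comm G x z := hw.1
        rcases trichotomous_of lt z x with h | rfl | h
        · exact hn₁ x [] z ⟨[], w, by simp⟩ ⟨.inl ⟨hxz.symm, h⟩, by simp⟩
        · exact hxz.ne rfl
        · exact hn₂ z w _ List.infix_rfl ⟨.inl ⟨hw.1, hlt _ _ hxz _ _ _ _ h⟩, hw.2⟩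

theorem ResolvesOverlaps.isComplete (hS : ResolvesOverlaps G lt S) (hwf : WellFounded lt)
    (hlt : OrientsEdges G lt) : IsComplete S := by
  refine ⟨hS.decreasing.isTerminating hwf, fun w u v hu hv => ?_⟩
  obtain ⟨u', hu', hui⟩ := hS.decreasing.exists_irreducible hwf u
  obtain ⟨v', hv', hvi⟩ := hS.decreasing.exists_irreducible hwf v
  have hc : Congruent S u' v' :=
    (ReducesStar.congruent (hu.trans hu')).symm.trans (ReducesStar.congruent (hv.trans hv'))
  obtain rfl := (hS.normal_of_isIrreducible hwf hlt hui).eq_of_congruent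
    (hS.normal_of_isIrreducible hwf hlt hvi) (.of_rules hS.congruent hc)
  exact ⟨u', hu', hv'⟩

end Confluence

/-! ### The positive part -/

section Positive

variable {V : Type*} {G : SimpleGraph V} {lt : Letter V → Letter V → Prop}
  {S : RewritingSystem (Letter V)}

/-- The sum of the exponents of a word. -/
def exponentSum (w : List (Letter V)) : ℤ := (w.map fun x => if x.2 then 1 else -1).sum

theorem exponentSum_append (u v : List (Letter V)) :
    exponentSum (u ++ v) = exponentSum u + exponentSum v := by simp [exponentSum]

theorem Congruent.exponentSum_eq {u v : List (Letter V)}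
    (h : Congruent (initialSystem G lt) u v) : exponentSum u = exponentSum v := by
  induction h with
  | rel u v h =>
    obtain ⟨s, t, l, r, hlr, rfl, rfl⟩ := h
    simp only [exponentSum_append, add_left_inj, add_right_inj]
    rcases hlr with ⟨a, b, ε, δ, -, -, e⟩ | ⟨a, ε, e⟩ <;> obtain ⟨rfl, rfl⟩ := Prod.mk.inj e
    · simp [exponentSum, add_comm]
    · cases ε <;> simp [exponentSum]
  | refl u => rfl
  | symm _ _ _ ih => exact ih.symm
  | trans _ _ _ _ _ ih₁ ih₂ => exact ih₁.trans ih₂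

theorem IsPositive.exponentSum_eq {w : List (Letter V)} (h : IsPositive w) :
    exponentSum w = w.length := by
  induction w with
  | nil => rfl
  | cons x w ih =>
    have hx := h x (by simp)
    have := ih fun y hy => h y (by simp [hy])
    simp only [exponentSum, List.map_cons, List.sum_cons, List.length_cons] at this ⊢
    simp [hx, this, add_comm]

theorem exponentSum_le (w : List (Letter V)) : exponentSum w ≤ w.length := by
  induction w with
  | nil => rfl
  | cons x w ih =>
    simp only [exponentSum, List.map_cons, List.sum_cons, List.length_cons] at ih ⊢
    split_ifs <;> push_cast <;> omega

theorem isPositive_of_length_le {w : List (Letter V)} (h : (w.length : ℤ) ≤ exponentSum w) :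
    IsPositive w := by
  induction w with
  | nil => simp [IsPositive]
  | cons x w ih =>
    have := exponentSum_le w
    rw [IsPositive, List.forall_mem_cons]
    simp only [exponentSum, List.map_cons, List.sum_cons, List.length_cons] at this h ih ⊢
    split_ifs at h with hx
    · exact ⟨hx, ih (by push_cast at h; omega)⟩
    · push_cast at h
      omega

theorem satisfiesCPlus_of_isDecreasing (hdec : IsDecreasing lt S)
    (hc : ∀ ρ ∈ S, Congruent (initialSystem G lt) ρ.1 ρ.2) : SatisfiesCPlus S := by
  intro ρ hρ hpos
  apply isPositive_of_length_le
  rw [← (hc ρ hρ).exponentSum_eq, hpos.exponentSum_eq]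
  rcases List.shortlex_def.1 (hdec ρ hρ) with h | ⟨h, -⟩
  · exact_mod_cast h.le
  · exact_mod_cast h.le

theorem IsPositive.reduced {w : List (Letter V)} (h : IsPositive w) : Reduced G w := by
  induction w with
  | nil => trivial
  | cons x w ih =>
    rw [IsPositive, List.forall_mem_cons] at h
    refine ⟨?_, ih h.2⟩
    rintro ⟨v, hv⟩
    obtain ⟨p, q, rfl, -⟩ := hv.exists_append
    have := h.2 (letterInv x) (by simp)
    simp [letterInv, h.1] at this

theorem isPositive_positiveWord (w : FreeMonoid V) : IsPositive (positiveWord w) := by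
  intro x hx
  obtain ⟨a, -, rfl⟩ := List.mem_map.1 hx
  rfl

theorem TraceEq.prod_eq {M : Type*} [Monoid M] (f : V → M)
    (hf : ∀ a b, G.Adj a b → f a * f b = f b * f a) {u v : List (Letter V)}
    (h : TraceEq G u v) : (u.map fun x => f x.1).prod = (v.map fun x => f x.1).prod := by
  induction h with
  | nil => rfl
  | cons x _ ih => simp [ih]
  | @swap x y u h => simp [← mul_assoc, hf _ _ h]
  | trans _ _ ih₁ ih₂ => exact ih₁.trans ih₂

theorem artinMonoid_of_mul_of {a b : V} (h : G.Adj a b) :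
    (PresentedMonoid.of _ a * PresentedMonoid.of _ b : ArtinMonoid G) =
      PresentedMonoid.of _ b * PresentedMonoid.of _ a :=
  PresentedMonoid.mk_eq_mk_of_rel ⟨a, b, h, rfl, rfl⟩

/-- The right-angled Artin monoid embeds in the right-angled Artin group. -/
theorem mk_eq_mk_of_congruent {u v : FreeMonoid V}
    (h : Congruent (initialSystem G lt) (positiveWord u) (positiveWord v)) :
    FreeMonoid.lift (fun a => (PresentedMonoid.of _ a : ArtinMonoid G)) u =
      FreeMonoid.lift (fun a => (PresentedMonoid.of _ a : ArtinMonoid G)) v := by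
  have h := h.traceEq (isPositive_positiveWord u).reduced (isPositive_positiveWord v).reduced
  have := h.prod_eq (fun a => (PresentedMonoid.of _ a : ArtinMonoid G))
    fun a b => artinMonoid_of_mul_of
  simpa [positiveWord, Function.comp_def, FreeMonoid.lift_apply] using this

theorem positiveFactorMonoid_of_mul_of [IsStrictTotalOrder (Letter V) lt]
    (h₀ : initialSystem G lt ⊆ S) {a b : V} (h : G.Adj a b) :
    (PresentedMonoid.of _ a * PresentedMonoid.of _ b : PositiveFactorMonoid S) =
      PresentedMonoid.of _ b * PresentedMonoid.of _ a := by
  have key : ∀ {a b : V}, G.Adj a b → lt (b, true) (a, true) →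
      (PresentedMonoid.of _ a * PresentedMonoid.of _ b : PositiveFactorMonoid S) =
        PresentedMonoid.of _ b * PresentedMonoid.of _ a := fun {a b} h hlt =>
    PresentedMonoid.mk_eq_mk_of_rel (x := FreeMonoid.of a * FreeMonoid.of b)
      (y := FreeMonoid.of b * FreeMonoid.of a)
      ⟨h₀ (Comm.mem_initialSystem (x := (a, true)) (y := (b, true)) h hlt),
        isPositive_positiveWord (FreeMonoid.of a * FreeMonoid.of b)⟩
  rcases trichotomous_of lt (a, true) (b, true) with hlt | e | hlt
  · exact (key h.symm hlt).symm
  · exact absurd (Prod.mk.inj e).1 h.ne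
  · exact key h hlt

theorem positivePartPresentsArtinMonoid [IsStrictTotalOrder (Letter V) lt]
    (h₀ : initialSystem G lt ⊆ S) (hdec : IsDecreasing lt S)
    (hc : ∀ ρ ∈ S, Congruent (initialSystem G lt) ρ.1 ρ.2) :
    PositivePartPresentsArtinMonoid G S := by
  refine ⟨satisfiesCPlus_of_isDecreasing hdec hc, ?_⟩
  let f : ArtinMonoid G →* PositiveFactorMonoid S :=
    PresentedMonoid.lift (fun a => PresentedMonoid.of _ a) (by
      rintro _ _ ⟨a, b, h, rfl, rfl⟩
      simpa using positiveFactorMonoid_of_mul_of h₀ h)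
  let g : PositiveFactorMonoid S →* ArtinMonoid G :=
    PresentedMonoid.lift (fun a => PresentedMonoid.of _ a) fun u v h =>
      mk_eq_mk_of_congruent (hc _ h.1)
  exact ⟨MonoidHom.toMulEquiv f g (PresentedMonoid.ext _ fun a => rfl)
    (PresentedMonoid.ext _ fun a => rfl), fun a => rfl⟩

end Positive

end RightAngledArtin

theorem proposition4p7 {V : Type*} [Finite V] (G : SimpleGraph V)
    (lt : RightAngledArtin.Letter V → RightAngledArtin.Letter V → Prop)
    [IsStrictTotalOrder (RightAngledArtin.Letter V) lt]
    (hlt : RightAngledArtin.OrientsEdges G lt) :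
    (∃ R, RightAngledArtin.IsCompletionRun lt (RightAngledArtin.initialSystem G lt) R) ∧
    ∀ R : ℕ → RightAngledArtin.RewritingSystem (RightAngledArtin.Letter V),
      RightAngledArtin.IsCompletionRun lt (RightAngledArtin.initialSystem G lt) R →
        RightAngledArtin.IsComplete (RightAngledArtin.limitSystem R) ∧
        RightAngledArtin.AreEquivalent (RightAngledArtin.limitSystem R)
          (RightAngledArtin.initialSystem G lt) ∧
        RightAngledArtin.PositivePartPresentsArtinMonoid G
          (RightAngledArtin.limitSystem R) ∧
        ∀ n, RightAngledArtin.PositivePartPresentsArtinMonoid G (R n) := by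
  have hwf : WellFounded lt := Finite.wellFounded_of_trans_of_irrefl lt
  have hdec := RightAngledArtin.initialSystem_isDecreasing (G := G) (lt := lt)
  refine ⟨⟨_, RightAngledArtin.exhaustiveRun_isCompletionRun hwf hdec⟩, fun R hR => ?_⟩
  have hS := hR.resolvesOverlaps
  refine ⟨hS.isComplete hwf hlt, hR.limitSystem_areEquivalent,
    RightAngledArtin.positivePartPresentsArtinMonoid hS.initial_subset hS.decreasing
      hS.congruent, fun n => ?_⟩
  refine RightAngledArtin.positivePartPresentsArtinMonoid ?_ (hR.isDecreasing hdec n)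
    (hR.congruent n)
  exact hR.zero ▸ hR.monotone (Nat.zero_le n)
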